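/- For an integer $n\ge 0$ let $a_{2,5}(n)$ denote the number of partitions of $n$ into distinct parts none of which is divisible by $2$ or by $5$ (so $a_{2,5}(0)=1$), and for $k\ge 1$ let $f_k=\prod_{m\ge 1}(1-q^{km})\in\mathbb{Z}[[q]]$. A congruence modulo $2$ between two power series with integer coefficients means that their coefficients are congruent modulo $2$ term by term. Let $p>5$ be a prime with Legendre symbol $\left(\frac{-10}{p}\right)=-1$. Then for all integers $\gamma\ge 0$, $$\sum_{n\ge 0} a_{2,5}\Big(4p^{2\gamma}n+\frac{7p^{2\gamma}-1}{6}\Big)q^n\equiv f_2f_5 \pmod 2,$$ $$\sum_{n\ge 0} a_{2,5}\Big(20p^{2\gamma}n+\frac{55p^{2\gamma}-1}{6}\Big)q^n\equiv f_1f_{10} \pmod 2,$$ and, for all integers $n\ge 0$ and all $1\le j\le p-1$, $$a_{2,5}\Big(4p^{2\gamma+1}(pn+j)+\frac{7p^{2\gamma+2}-1}{6}\Big)\equiv 0 \pmod 2,$$ $$a_{2,5}\Big(20p^{2\gamma+1}(pn+j)+\frac{55p^{2\gamma+2}-1}{6}\Big)\equiv 0 \pmod 2.$$ -/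

import Mathlib

namespace RegularPartitions

open PowerSeries
open scoped PowerSeries.WithPiTopology

/-- `a r s n` is the number of partitions of `n` into distinct parts, none of which is divisible
by `r` or by `s`. -/
def a (r s n : ℕ) : ℕ :=
  (Finset.univ.filter fun π : n.Partition =>
    π.parts.Nodup ∧ ∀ i ∈ π.parts, ¬ r ∣ i ∧ ¬ s ∣ i).card

/-- `f k = (q^k; q^k)_∞ = ∏_{m ≥ 0} (1 - q^k (q^k)^m)` as a formal power series over `ℤ`,
the infinite product being taken coefficientwise. -/
noncomputable def f (k : ℕ) : PowerSeries ℤ :=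
  ∏' m : ℕ, (1 - X ^ (k * (m + 1)))

/-- The infinite product defining `f k` converges for `k ≥ 1`. -/
theorem multipliable_f (k : ℕ) (hk : 1 ≤ k) :
    Multipliable fun m : ℕ => (1 - X ^ (k * (m + 1)) : PowerSeries ℤ) := by
  simp_rw [sub_eq_add_neg]
  apply PowerSeries.WithPiTopology.multipliable_one_add_of_tendsto_order_atTop_nhds_top
  simp only [order_neg, order_X_pow]
  refine ENat.tendsto_nhds_top_iff_natCast_lt.mpr fun n => Filter.eventually_atTop.mpr ⟨n, ?_⟩
  intro m hm
  exact_mod_cast (show n < k * (m + 1) by nlinarith)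

/-- Congruence of integral power series modulo `M`: all coefficients are congruent. -/
def SeriesModEq (M : ℤ) (A B : PowerSeries ℤ) : Prop :=
  ∀ n : ℕ, coeff n A ≡ coeff n B [ZMOD M]

end RegularPartitions

/-! Modulo 2, Euler's pentagonal theorem makes `f k` the indicator series of `k * pentagonal i`.
Since `24 * pentagonal i + 1 = (1 - 6 * i) ^ 2`, the coefficient of `q^N` in `f a * f b` has the
parity of `thetaReps a b (24 * N + a + b)` (`coeff_fmod_mul_fmod`). The generating function of `a 2
5` is `f₅ / f₁` modulo 2. The congruence `f₁ f₅ ≡ f₂³ + q f₁₀³` (`fmod_one_mul_fmod_five`) splits it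
into even and odd exponents. Two such dissections give `f₂ f₅` along `4n + 1`, so for `m ≡ 1` modulo
4 the parity of `a 2 5 m` is that of the number of solutions of `2u² + 5v² = 6m + 1` with `u ≡ v ≡
1` modulo 6 (`a_eq_ncard_thetaReps`). As `-10` is a nonresidue, `p ∣ 2u² + 5v²` forces `p ∣ u` and
`p ∣ v`. Hence factors `p²` do not change the count, and a single leftover factor `p` makes it zero.
The dissection itself is a parity count of representations by `x² + 5y²`, and Jacobi's `f₁³` modulo
2 one by `x² + 2y²`. Both use an involution modulo 3, after factors of 3 are removed. -/

namespace RegularPartitions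

/-! ### Parity of representation numbers of `x² + 2y²` and `x² + 5y²` -/

open Set

/-- Representations of `M` by `x ^ 2 + d * y ^ 2` with `x + y ≡ 1` modulo `3`. -/
def reps (d M : ℤ) : Set (ℤ × ℤ) :=
  {z | z.1 ^ 2 + d * z.2 ^ 2 = M ∧ (z.1 + z.2) % 3 = 1}

/-- Representations of `K` by `a * u ^ 2 + b * v ^ 2` with `u ≡ v ≡ 1` modulo `6`. -/
def thetaReps (a b K : ℤ) : Set (ℤ × ℤ) :=
  {z | a * z.1 ^ 2 + b * z.2 ^ 2 = K ∧ z.1 % 6 = 1 ∧ z.2 % 6 = 1}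

theorem sq_emod_three (x : ℤ) : x % 3 = 0 ∧ x ^ 2 % 3 = 0 ∨ x % 3 = 1 ∧ x ^ 2 % 3 = 1 ∨
    x % 3 = 2 ∧ x ^ 2 % 3 = 1 := by
  have h : x % 3 = 0 ∨ x % 3 = 1 ∨ x % 3 = 2 := by omega
  rcases h with h | h | h <;> simp [h, pow_two, Int.mul_emod]

theorem sq_emod_eight (x : ℤ) : x % 2 = 0 ∧ (x ^ 2 % 8 = 0 ∨ x ^ 2 % 8 = 4) ∨
    x % 2 = 1 ∧ x ^ 2 % 8 = 1 := by
  have h : x % 8 = 0 ∨ x % 8 = 1 ∨ x % 8 = 2 ∨ x % 8 = 3 ∨ x % 8 = 4 ∨ x % 8 = 5 ∨ x % 8 = 6 ∨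
    x % 8 = 7 := by omega
  rcases h with h | h | h | h | h | h | h | h <;> simp [h, pow_two, Int.mul_emod] <;> omega

theorem not_isSquare_of_three_exact {M : ℤ} (hM : ¬ 3 ∣ M) : ¬ IsSquare (3 * M) := by
  rintro ⟨x, hx⟩
  rcases sq_emod_three x with h | h | h
  · obtain ⟨k, rfl⟩ := Int.dvd_of_emod_eq_zero h.1
    exact hM ⟨k * k, by linarith⟩
  all_goals rw [pow_two] at h; omega

theorem isSquare_nine_mul {M : ℤ} : IsSquare (9 * M) ↔ IsSquare M := by
  constructor
  · rintro ⟨x, hx⟩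
    rcases sq_emod_three x with h | h | h
    · obtain ⟨k, rfl⟩ := Int.dvd_of_emod_eq_zero h.1
      exact ⟨k, by linarith⟩
    all_goals rw [pow_two] at h; omega
  · rintro ⟨x, rfl⟩
    exact ⟨3 * x, by ring⟩

theorem not_isSquare_of_emod_eight {M : ℤ} (hM : M % 8 = 3) : ¬ IsSquare M := by
  rintro ⟨x, rfl⟩
  rw [← pow_two] at hM
  rcases sq_emod_eight x with h | h <;> omega

theorem reps_finite {d : ℤ} (hd : 0 < d) (M : ℤ) : (reps d M).Finite := by
  refine ((Set.finite_Icc (-M) M).prod (Set.finite_Icc (-M) M)).subset ?_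
  rintro ⟨x, y⟩ ⟨h, -⟩
  simp only at h
  have hx : |x| ≤ x ^ 2 := by
    rw [← sq_abs]; nlinarith [abs_nonneg x, Int.le_self_sq |x|]
  have hy : |y| ≤ y ^ 2 := by
    rw [← sq_abs]; nlinarith [abs_nonneg y, Int.le_self_sq |y|]
  have h1 : |x| ≤ M := by nlinarith [sq_nonneg y, abs_nonneg y]
  have h2 : |y| ≤ M := by nlinarith [sq_nonneg x, abs_nonneg y]
  exact ⟨abs_le.mp h1, abs_le.mp h2⟩

/-- Modulo `2`, a finite set has as many elements as an involution of it has fixed points. -/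
theorem ncard_eq_ncard_fixed {α : Type*} {s : Set α} (hs : s.Finite) (σ : α → α)
    (hσ : ∀ a ∈ s, σ a ∈ s) (hσσ : ∀ a ∈ s, σ (σ a) = a) :
    (s.ncard : ZMod 2) = ({a ∈ s | σ a = a}.ncard : ZMod 2) := by
  classical
  have hf : {a ∈ s | σ a = a}.Finite := hs.subset (sep_subset _ _)
  rw [ncard_eq_toFinset_card _ hs, ncard_eq_toFinset_card _ hf]
  have h0 : ∑ a ∈ hs.toFinset, (if σ a = a then (0 : ZMod 2) else 1) = 0 := by
    refine Finset.sum_involution (fun a _ => σ a) ?_ ?_ ?_ ?_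
    · intro a ha
      have ha' := hs.mem_toFinset.mp ha
      rw [hσσ a ha']
      by_cases h : σ a = a
      · simp [h]
      · rw [if_neg h, if_neg (Ne.symm h)]; rfl
    · intro a _ h h'
      simp [h'] at h
    · intro a ha
      simpa using hσ a (hs.mem_toFinset.mp ha)
    · intro a ha
      exact hσσ a (hs.mem_toFinset.mp ha)
  have h1 : hf.toFinset = hs.toFinset.filter (fun a => σ a = a) := by
    ext a; simp
  rw [h1, Finset.card_filter, Finset.card_eq_sum_ones]
  push_cast
  rw [← sub_eq_zero, ← Finset.sum_sub_distrib]
  refine (Finset.sum_congr rfl fun a _ => ?_).trans h0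
  split_ifs <;> simp

open Classical in
theorem ncard_sq_eq {d M : ℤ} (hd : d ≠ 0) (hM : ¬ 3 ∣ M) :
    {x : ℤ | d * x ^ 2 = M ∧ x % 3 = 1}.ncard = if ∃ x, d * x ^ 2 = M then 1 else 0 := by
  split_ifs with h
  · obtain ⟨x, rfl⟩ := h
    have hx : x % 3 ≠ 0 := fun h => by
      obtain ⟨k, rfl⟩ := Int.dvd_of_emod_eq_zero h
      exact hM ⟨d * (3 * k ^ 2), by ring⟩
    have key : ∀ y : ℤ, d * y ^ 2 = d * x ^ 2 ↔ y = x ∨ y = -x := fun y => by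
      rw [mul_right_inj' hd, sq_eq_sq_iff_eq_or_eq_neg]
    rw [ncard_eq_one]
    rcases (show x % 3 = 1 ∨ x % 3 = 2 by omega) with h | h
    · refine ⟨x, Set.ext fun y => ?_⟩
      simp only [key, mem_ofPred_eq, mem_singleton_iff]
      constructor <;> omega
    · refine ⟨-x, Set.ext fun y => ?_⟩
      simp only [key, mem_ofPred_eq, mem_singleton_iff]
      constructor <;> omega
  · convert ncard_empty ℤ
    ext x
    simp only [mem_ofPred_eq, mem_empty_iff_false, iff_false]
    exact fun hx => h ⟨x, hx.1⟩

-- As `x² + d y² ≡ x² - y²` modulo 3 is nonzero, exactly one coordinate is divisible by 3. Changing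
-- its sign is an involution preserving `x + y` modulo 3, and its fixed points lie on the axes.
open Classical in
theorem ncard_reps_of_not_dvd {d M : ℤ} (hd : 0 < d) (hd3 : d % 3 = 2) (hM : ¬ 3 ∣ M) :
    ((reps d M).ncard : ZMod 2) =
      (if IsSquare M then 1 else 0) + (if ∃ y, d * y ^ 2 = M then 1 else 0) := by
  have hxy : ∀ x y : ℤ, x ^ 2 + d * y ^ 2 = M → (x - y) % 3 ≠ 0 := fun x y h h' => by
    obtain ⟨k, hk⟩ := Int.dvd_of_emod_eq_zero h'
    obtain ⟨e, he⟩ : ∃ e, d = 3 * e + 2 := ⟨d / 3, by omega⟩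
    refine hM ⟨3 * k ^ 2 + 2 * k * y + (e + 1) * y ^ 2, ?_⟩
    obtain rfl : x = y + 3 * k := by omega
    rw [← h, he]; ring
  let σ : ℤ × ℤ → ℤ × ℤ := fun z => if (z.1 - z.2) % 3 = 1 then (z.1, -z.2) else (-z.1, z.2)
  rw [ncard_eq_ncard_fixed (reps_finite hd M) σ]
  · have hset : {a ∈ reps d M | σ a = a} =
        (fun x : ℤ => (x, (0 : ℤ))) '' {x : ℤ | 1 * x ^ 2 = M ∧ x % 3 = 1} ∪
        (fun y : ℤ => ((0 : ℤ), y)) '' {x : ℤ | d * x ^ 2 = M ∧ x % 3 = 1} := by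
      ext ⟨x, y⟩
      simp only [reps, σ, mem_ofPred_eq, mem_union, mem_image, Prod.mk.injEq]
      constructor
      · rintro ⟨⟨h1, h2⟩, h3⟩
        split_ifs at h3 with h
        · obtain rfl : y = 0 := by simp only [Prod.mk.injEq] at h3; omega
          exact Or.inl ⟨x, ⟨by linarith, by omega⟩, rfl, rfl⟩
        · obtain rfl : x = 0 := by simp only [Prod.mk.injEq] at h3; omega
          exact Or.inr ⟨y, ⟨by linarith, by omega⟩, rfl, rfl⟩
      · rintro (⟨x, ⟨h1, h2⟩, rfl, rfl⟩ | ⟨y, ⟨h1, h2⟩, rfl, rfl⟩)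
        · simp [h2]; linarith
        · have : (0 - y) % 3 ≠ 1 := by omega
          simp [h2]; exact ⟨h1, fun _ => by omega⟩
    have hfin : ∀ t : Set (ℤ × ℤ), t ⊆ {a ∈ reps d M | σ a = a} → t.Finite := fun t ht =>
      (reps_finite hd M).subset (ht.trans (sep_subset _ _))
    rw [hset, ncard_union_eq ?_ (hfin _ (hset ▸ subset_union_left))
      (hfin _ (hset ▸ subset_union_right)), ncard_image_of_injective, ncard_image_of_injective,
      ncard_sq_eq one_ne_zero hM, ncard_sq_eq hd.ne' hM]
    · have : IsSquare M ↔ ∃ x, 1 * x ^ 2 = M := by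
        constructor
        · rintro ⟨x, rfl⟩; exact ⟨x, by ring⟩
        · rintro ⟨x, rfl⟩; exact ⟨x, by ring⟩
      rw [if_congr this rfl rfl]
      push_cast
      rfl
    · intro a b h; simpa using h
    · intro a b h; simpa using h
    · rw [disjoint_left]
      rintro _ ⟨x, ⟨-, hx⟩, rfl⟩ ⟨y, ⟨-, hy⟩, h⟩
      simp only [Prod.mk.injEq] at h
      omega
  · rintro ⟨x, y⟩ ⟨h1, h2⟩
    have := hxy x y h1
    simp only [σ, reps, mem_ofPred_eq] at *
    split_ifs with h
    · exact ⟨by rw [← h1]; ring, by simp only; omega⟩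
    · exact ⟨by rw [← h1]; ring, by simp only; omega⟩
  · rintro ⟨x, y⟩ ⟨h1, h2⟩
    have := hxy x y h1
    simp only [σ] at *
    split_ifs with h h' h'
    · simp
    · simp only at h'; omega
    · simp only at h'; omega
    · simp

theorem emod_three_of_mem_reps {d M x y : ℤ} (hd3 : d % 3 = 2) (h : x ^ 2 + d * y ^ 2 = 3 * M)
    (hxy : (x + y) % 3 = 1) : x % 3 = 2 ∧ y % 3 = 2 := by
  have h' : (x ^ 2 + d * y ^ 2) % 3 = 0 := by omega
  rw [Int.add_emod, Int.mul_emod, hd3] at h'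
  rcases sq_emod_three x with hx | hx | hx <;> rcases sq_emod_three y with hy | hy | hy <;>
    rw [hx.2, hy.2] at h' <;> omega

/-- Multiplication by `-1 - √-2`, of norm 3, is a bijection: modulo 3 both coordinates on the left
are 2, which makes the quotient integral. -/
theorem ncard_reps_two_three_mul (M : ℤ) : (reps 2 (3 * M)).ncard = (reps 2 M).ncard := by
  rw [← ncard_image_of_injective (f := fun z : ℤ × ℤ => (-z.1 + 2 * z.2, -z.1 - z.2)) (reps 2 M)]
  · congr 1
    ext ⟨x, y⟩
    simp only [reps, mem_ofPred_eq, mem_image, Prod.exists, Prod.mk.injEq]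
    constructor
    · rintro ⟨h1, h2⟩
      obtain ⟨hx, hy⟩ := emod_three_of_mem_reps (by norm_num) h1 h2
      obtain ⟨Y, hY⟩ : ∃ Y, x - y = 3 * Y := ⟨(x - y) / 3, by omega⟩
      obtain rfl : x = y + 3 * Y := by omega
      exact ⟨-y - Y, Y, ⟨by linarith, by omega⟩, by ring, by ring⟩
    · rintro ⟨X, Y, ⟨h1, h2⟩, rfl, rfl⟩
      exact ⟨by rw [← h1]; ring, by omega⟩
  · rintro ⟨x, y⟩ ⟨z, w⟩ h
    simp only [Prod.mk.injEq] at h ⊢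
    omega

/-- `ℤ[√-5]` has no element of norm 3, but `2 - √-5` has norm 9 and multiplication by it is a
bijection. -/
theorem ncard_reps_five_nine_mul (M : ℤ) : (reps 5 (9 * M)).ncard = (reps 5 M).ncard := by
  rw [← ncard_image_of_injective (f := fun z : ℤ × ℤ => (2 * z.1 + 5 * z.2, 2 * z.2 - z.1))
    (reps 5 M)]
  · congr 1
    ext ⟨x, y⟩
    simp only [reps, mem_ofPred_eq, mem_image, Prod.exists, Prod.mk.injEq]
    constructor
    · rintro ⟨h1, h2⟩
      obtain ⟨hx, hy⟩ := emod_three_of_mem_reps (d := 5) (M := 3 * M) (by norm_num)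
        (by rw [h1]; ring) h2
      obtain ⟨a, rfl⟩ : ∃ a, x = 3 * a + 2 := ⟨x / 3, by omega⟩
      obtain ⟨b, rfl⟩ : ∃ b, y = 3 * b + 2 := ⟨y / 3, by omega⟩
      have h3 : 9 * (a ^ 2 + 5 * b ^ 2) + 12 * a + 60 * b + 24 = 9 * M := by rw [← h1]; ring
      -- Reducing `h3` modulo 9 gives `a ≡ b - 2` modulo 3; the quadratic part is a multiple of 9.
      obtain ⟨k, rfl⟩ : ∃ k, a = 3 * k + b - 2 := ⟨(a - b + 2) / 3, by
        generalize a ^ 2 + 5 * b ^ 2 = t at h3; omega⟩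
      refine ⟨2 * k - b - 2, k + b, ⟨?_, by omega⟩, by ring, by ring⟩
      linarith
    · rintro ⟨X, Y, ⟨h1, h2⟩, rfl, rfl⟩
      exact ⟨by rw [← h1]; ring, by omega⟩
  · rintro ⟨x, y⟩ ⟨z, w⟩ h
    simp only [Prod.mk.injEq] at h ⊢
    omega

/-- The map is multiplication by `(1 - √-5) / 3`, of norm `2/3`. It trades a factor 3 for a factor
2, so the involution applies when 3 divides exactly once. -/
theorem ncard_reps_five_three_mul (M : ℤ) : (reps 5 (3 * M)).ncard = (reps 5 (2 * M)).ncard := by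
  refine ncard_congr (fun z _ => ((z.1 + 5 * z.2) / 3, (z.2 - z.1) / 3)) ?_ ?_ ?_
  · rintro ⟨x, y⟩ ⟨h1, h2⟩
    simp only at h1 h2
    obtain ⟨hx, hy⟩ := emod_three_of_mem_reps (by norm_num) h1 h2
    obtain ⟨Y, hY⟩ : ∃ Y, y - x = 3 * Y := ⟨(y - x) / 3, by omega⟩
    obtain rfl : x = y - 3 * Y := by omega
    refine ⟨?_, by simp only; omega⟩
    simp only
    rw [show (y - 3 * Y + 5 * y) / 3 = 2 * y - Y by omega,
      show (y - (y - 3 * Y)) / 3 = Y by omega]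
    linarith
  · rintro ⟨x, y⟩ ⟨z, w⟩ ⟨h1, h2⟩ ⟨h3, h4⟩ h
    obtain ⟨hx, hy⟩ := emod_three_of_mem_reps (by norm_num) h1 h2
    obtain ⟨hz, hw⟩ := emod_three_of_mem_reps (by norm_num) h3 h4
    simp only [Prod.mk.injEq] at *
    omega
  · rintro ⟨X, Y⟩ ⟨h1, h2⟩
    simp only at h1 h2
    have hpar : (X - Y) % 2 = 0 := by
      rcases sq_emod_eight X with h | h <;> rcases sq_emod_eight Y with h' | h' <;> omega
    obtain ⟨k, hk⟩ : ∃ k, X - Y = 2 * k := ⟨(X - Y) / 2, by omega⟩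
    obtain rfl : X = Y + 2 * k := by omega
    refine ⟨(k - 2 * Y, k + Y), ⟨?_, ?_⟩, ?_⟩
    · simp only; linarith
    · simp only; omega
    · simp only [Prod.mk.injEq]; omega

open Classical in
theorem ncard_reps_two (M : ℕ) (hM : M % 8 = 1) :
    ((reps 2 M).ncard : ZMod 2) = if IsSquare (M : ℤ) then 1 else 0 := by
  induction M using Nat.strong_induction_on with
  | _ M ih =>
    have hno : ∀ K : ℤ, K % 2 = 1 → ¬ ∃ y, 2 * y ^ 2 = K := by rintro K hK ⟨y, rfl⟩; omega
    by_cases h3 : 3 ∣ M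
    · obtain ⟨K, rfl⟩ := h3
      push_cast
      rw [ncard_reps_two_three_mul]
      by_cases h9 : 3 ∣ K
      · obtain ⟨J, rfl⟩ := h9
        push_cast
        rw [ncard_reps_two_three_mul, ih J (by omega) (by omega), ← mul_assoc]
        norm_num only [isSquare_nine_mul]
      · rw [ncard_reps_of_not_dvd (by norm_num) (by norm_num) (by omega),
          if_neg (not_isSquare_of_emod_eight (by omega)), if_neg (hno _ (by omega)),
          if_neg (not_isSquare_of_three_exact (by omega)), add_zero]
    · rw [ncard_reps_of_not_dvd (by norm_num) (by norm_num) (by omega),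
        if_neg (hno _ (by omega)), add_zero]

open Classical in
theorem ncard_reps_five (M : ℕ) (hM : M % 2 = 1) :
    ((reps 5 M).ncard : ZMod 2) =
      (if IsSquare (M : ℤ) then 1 else 0) + (if ∃ y : ℤ, 5 * y ^ 2 = M then 1 else 0) := by
  have hfive : ∀ K : ℤ, (∃ y : ℤ, 5 * y ^ 2 = K) ↔ IsSquare (5 * K) := by
    intro K
    constructor
    · rintro ⟨y, rfl⟩; exact ⟨5 * y, by ring⟩
    · rintro ⟨y, hy⟩
      have : (5 : ℤ) ∣ y := Int.Prime.dvd_pow' (k := 2) (by norm_num) ⟨K, by push_cast; rw [hy]; ring⟩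
      obtain ⟨k, rfl⟩ := this
      exact ⟨k, by linarith⟩
  induction M using Nat.strong_induction_on with
  | _ M ih =>
    by_cases h3 : 3 ∣ M
    · obtain ⟨K, rfl⟩ := h3
      by_cases h9 : 3 ∣ K
      · obtain ⟨J, rfl⟩ := h9
        push_cast
        rw [← mul_assoc, show (3 * 3 : ℤ) = 9 by norm_num, ncard_reps_five_nine_mul,
          ih J (by omega) (by omega), if_congr isSquare_nine_mul rfl rfl]
        congr 1
        refine if_congr ?_ rfl rfl
        rw [hfive, hfive, mul_left_comm, isSquare_nine_mul]
      · push_cast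
        rw [ncard_reps_five_three_mul, ncard_reps_of_not_dvd (by norm_num) (by norm_num) (by omega),
          if_neg (not_isSquare_of_three_exact (by omega)), hfive, hfive, mul_left_comm 5 3,
          if_neg (not_isSquare_of_three_exact (M := 5 * K) (by omega)), if_neg, if_neg]
        · rintro ⟨y, hy⟩
          rw [← pow_two] at hy
          rcases sq_emod_eight y with h | h <;> omega
        · rintro ⟨y, hy⟩
          rw [← pow_two] at hy
          rcases sq_emod_eight y with h | h <;> omega
    · rw [ncard_reps_of_not_dvd (by norm_num) (by norm_num) (by omega)]

/-! ### Changes of variables for the theta counts -/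

theorem ncard_thetaReps_one_two {M : ℤ} (hM : M % 8 = 1) :
    (thetaReps 1 2 (3 * M)).ncard = (reps 2 M).ncard := by
  rw [← ncard_image_of_injective (f := fun z : ℤ × ℤ => (z.1 - 2 * z.2, z.1 + z.2)) (reps 2 M)]
  · congr 1
    ext ⟨u, v⟩
    simp only [reps, thetaReps, mem_ofPred_eq, mem_image, Prod.exists, Prod.mk.injEq]
    constructor
    · rintro ⟨h1, h2, h3⟩
      obtain ⟨y, hy⟩ : ∃ y, v - u = 3 * y := ⟨(v - u) / 3, by omega⟩
      obtain rfl : v = u + 3 * y := by omega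
      exact ⟨u + 2 * y, y, ⟨by linarith, by omega⟩, by ring, by ring⟩
    · rintro ⟨x, y, ⟨h1, h2⟩, rfl, rfl⟩
      refine ⟨by rw [← h1]; ring, ?_⟩
      -- `M ≡ 1` modulo 8 forces `x` odd and `y` even, so both new coordinates are odd; modulo 3
      -- both equal `x + y`.
      rcases sq_emod_eight x with h | h <;> rcases sq_emod_eight y with h' | h' <;> omega
  · rintro ⟨x, y⟩ ⟨z, w⟩ h
    simp only [Prod.mk.injEq] at h ⊢
    omega

theorem ncard_thetaReps_one_five {M : ℤ} (hM : M % 2 = 1) :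
    (thetaReps 1 5 (6 * M)).ncard = (reps 5 M).ncard := by
  rw [← ncard_image_of_injective (f := fun z : ℤ × ℤ => (z.1 - 5 * z.2, z.1 + z.2)) (reps 5 M)]
  · congr 1
    ext ⟨u, v⟩
    simp only [reps, thetaReps, mem_ofPred_eq, mem_image, Prod.exists, Prod.mk.injEq]
    constructor
    · rintro ⟨h1, h2, h3⟩
      obtain ⟨y, hy⟩ : ∃ y, v - u = 6 * y := ⟨(v - u) / 6, by omega⟩
      obtain rfl : v = u + 6 * y := by omega
      exact ⟨u + 5 * y, y, ⟨by linarith, by omega⟩, by ring, by ring⟩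
    · rintro ⟨x, y, ⟨h1, h2⟩, rfl, rfl⟩
      refine ⟨by rw [← h1]; ring, ?_⟩
      rcases sq_emod_eight x with h | h <;> rcases sq_emod_eight y with h' | h' <;> omega
  · rintro ⟨x, y⟩ ⟨z, w⟩ h
    simp only [Prod.mk.injEq] at h ⊢
    omega

theorem ncard_thetaReps_two_five (K : ℤ) :
    (thetaReps 2 5 (5 * K)).ncard = (thetaReps 1 10 K).ncard := by
  rw [← ncard_image_of_injective (f := fun z : ℤ × ℤ => (-5 * z.2, z.1)) (thetaReps 1 10 K)]
  · congr 1
    ext ⟨u, v⟩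
    simp only [thetaReps, mem_ofPred_eq, mem_image, Prod.exists, Prod.mk.injEq]
    constructor
    · rintro ⟨h1, h2, h3⟩
      have : (5 : ℤ) ∣ u := by
        refine Int.Prime.dvd_pow' (k := 2) (by norm_num) ?_
        push_cast
        omega
      obtain ⟨w, rfl⟩ := this
      exact ⟨v, -w, ⟨by linarith, h3, by omega⟩, by ring, rfl⟩
    · rintro ⟨x, y, ⟨h1, h2, h3⟩, rfl, rfl⟩
      exact ⟨by rw [← h1]; ring, by omega, h2⟩
  · rintro ⟨x, y⟩ ⟨z, w⟩ h
    simp only [Prod.mk.injEq] at h ⊢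
    omega

/-! ### Divisibility of `2u² + 5v²` by `p` -/

theorem dvd_of_dvd_two_five {p : ℕ} [hpp : Fact p.Prime] (hp : 5 < p)
    (hleg : legendreSym p (-10) = -1) {u v : ℤ} (h : (p : ℤ) ∣ 2 * u ^ 2 + 5 * v ^ 2) :
    (p : ℤ) ∣ u ∧ (p : ℤ) ∣ v := by
  obtain ⟨hu, hv⟩ := legendreSym.prime_dvd_of_eq_neg_one hleg (x := 2 * u) (y := v)
    ((h.mul_left 2).trans ⟨1, by ring⟩)
  refine ⟨?_, hv⟩
  rcases (Nat.prime_iff_prime_int.mp hpp.out).dvd_mul.mp hu with h2 | h2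
  · have := Int.le_of_dvd (by norm_num) h2
    omega
  · exact h2

theorem prime_emod_six {p : ℕ} (hpp : p.Prime) (hp : 5 < p) : p % 6 = 1 ∨ p % 6 = 5 := by
  have h2 : ¬ 2 ∣ p := fun h => by rw [Nat.prime_dvd_prime_iff_eq Nat.prime_two hpp] at h; omega
  have h3 : ¬ 3 ∣ p := fun h => by rw [Nat.prime_dvd_prime_iff_eq Nat.prime_three hpp] at h; omega
  omega

theorem ncard_thetaReps_prime_sq_mul {p : ℕ} [hpp : Fact p.Prime] (hp : 5 < p)
    (hleg : legendreSym p (-10) = -1) (K : ℤ) :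
    (thetaReps 2 5 ((p : ℤ) ^ 2 * K)).ncard = (thetaReps 2 5 K).ncard := by
  -- The sign `e` makes scaling by `e * p` preserve residues modulo 6.
  obtain ⟨e, he, hep⟩ : ∃ e : ℤ, e ^ 2 = 1 ∧ e * p % 6 = 1 := by
    rcases prime_emod_six hpp.out hp with h | h
    · exact ⟨1, by norm_num, by omega⟩
    · exact ⟨-1, by norm_num, by omega⟩
  have hp0 : (p : ℤ) ≠ 0 := by omega
  have he0 : e ≠ 0 := by rintro rfl; norm_num at he
  have hmod : ∀ x : ℤ, (e * p * x) % 6 = x % 6 := fun x => by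
    rw [Int.mul_emod, hep, one_mul, Int.emod_emod_of_dvd _ dvd_rfl]
  rw [← ncard_image_of_injective (f := fun z : ℤ × ℤ => (e * p * z.1, e * p * z.2))
    (thetaReps 2 5 K)]
  · congr 1
    ext ⟨u, v⟩
    simp only [thetaReps, mem_ofPred_eq, mem_image, Prod.exists, Prod.mk.injEq]
    constructor
    · rintro ⟨h1, h2, h3⟩
      obtain ⟨⟨x, rfl⟩, ⟨y, rfl⟩⟩ := dvd_of_dvd_two_five hp hleg (u := u) (v := v)
        ⟨p * K, by rw [h1]; ring⟩
      have hx : (p : ℤ) * x = e * p * (e * x) := by linear_combination (-(p : ℤ) * x) * he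
      have hy : (p : ℤ) * y = e * p * (e * y) := by linear_combination (-(p : ℤ) * y) * he
      rw [hx, hmod] at h2
      rw [hy, hmod] at h3
      refine ⟨e * x, e * y, ⟨?_, h2, h3⟩, hx.symm, hy.symm⟩
      apply mul_left_cancel₀ (pow_ne_zero 2 hp0)
      linear_combination h1 + (p : ℤ) ^ 2 * (2 * x ^ 2 + 5 * y ^ 2) * he
    · rintro ⟨x, y, ⟨h1, h2, h3⟩, rfl, rfl⟩
      refine ⟨?_, by rw [hmod, h2], by rw [hmod, h3]⟩
      linear_combination (p : ℤ) ^ 2 * h1 + (p : ℤ) ^ 2 * (2 * x ^ 2 + 5 * y ^ 2) * he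
  · rintro ⟨x, y⟩ ⟨z, w⟩ h
    simpa [he0, hpp.out.ne_zero] using h

theorem ncard_thetaReps_prime_pow_mul {p : ℕ} [hpp : Fact p.Prime] (hp : 5 < p)
    (hleg : legendreSym p (-10) = -1) (k : ℕ) (K : ℤ) :
    (thetaReps 2 5 ((p : ℤ) ^ (2 * k) * K)).ncard = (thetaReps 2 5 K).ncard := by
  induction k with
  | zero => simp
  | succ k ih =>
    rw [← ih, ← ncard_thetaReps_prime_sq_mul hp hleg (p ^ (2 * k) * K)]
    congr 2
    ring

theorem thetaReps_prime_mul_eq_empty {p : ℕ} [hpp : Fact p.Prime] (hp : 5 < p)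
    (hleg : legendreSym p (-10) = -1) {K : ℤ} (hK : ¬ (p : ℤ) ∣ K) :
    thetaReps 2 5 (p * K) = ∅ := by
  ext ⟨u, v⟩
  simp only [thetaReps, mem_ofPred_eq, mem_empty_iff_false, iff_false]
  rintro ⟨h, -⟩
  obtain ⟨⟨x, rfl⟩, ⟨y, rfl⟩⟩ := dvd_of_dvd_two_five hp hleg (u := u) (v := v) ⟨K, h⟩
  refine hK ⟨2 * x ^ 2 + 5 * y ^ 2, ?_⟩
  apply mul_left_cancel₀ (show (p : ℤ) ≠ 0 by omega)
  linear_combination -h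

end RegularPartitions

/-! ### Eta products modulo 2 -/

namespace RegularPartitions

open PowerSeries
open scoped PowerSeries.WithPiTopology

/-- The reduction of `f k` modulo `2`. -/
noncomputable def fmod (k : ℕ) : PowerSeries (ZMod 2) :=
  PowerSeries.map (Int.castRingHom (ZMod 2)) (f k)

theorem continuous_map_of_discrete {R S : Type*} [CommRing R] [CommRing S] [TopologicalSpace R]
    [TopologicalSpace S] [DiscreteTopology R] (φ : R →+* S) :
    Continuous (PowerSeries.map φ) := by
  rw [continuous_iff_continuousAt]
  intro A
  rw [ContinuousAt, WithPiTopology.tendsto_iff_coeff_tendsto]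
  intro d
  simp only [coeff_map]
  exact ((continuous_of_discreteTopology (f := φ)).comp
    (WithPiTopology.continuous_coeff R d)).continuousAt

theorem continuous_expand {R : Type*} [CommRing R] [TopologicalSpace R] {k : ℕ} (hk : k ≠ 0) :
    Continuous (PowerSeries.expand (R := R) k hk) := by
  rw [continuous_iff_continuousAt]
  intro A
  rw [ContinuousAt, WithPiTopology.tendsto_iff_coeff_tendsto]
  intro d
  simp only [coeff_expand]
  split_ifs
  · exact (WithPiTopology.continuous_coeff R _).continuousAt
  · exact tendsto_const_nhds

theorem hasProd_fmod {k : ℕ} (hk : 1 ≤ k) :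
    HasProd (fun m : ℕ => (1 - X ^ (k * (m + 1)) : PowerSeries (ZMod 2))) (fmod k) := by
  have h := (multipliable_f k hk).hasProd.map (PowerSeries.map (Int.castRingHom (ZMod 2)))
    (continuous_map_of_discrete _)
  convert h using 1
  · ext1 m
    simp
  · rfl

theorem fmod_eq_expand {k : ℕ} (hk : k ≠ 0) :
    fmod k = expand k hk (pentagonalSeries (ZMod 2)) := by
  have h := (WithPiTopology.hasProd_one_sub_X_pow (ZMod 2)).map (expand k hk)
    (continuous_expand hk)
  refine (hasProd_fmod (Nat.one_le_iff_ne_zero.mpr hk)).unique ?_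
  convert h using 1
  ext1 m
  simp [pow_mul]

theorem expand_two_eq_sq (A : PowerSeries (ZMod 2)) : expand 2 two_ne_zero A = A ^ 2 := by
  have h := MvPowerSeries.map_frobenius_expand (R := ZMod 2) 2 two_ne_zero (f := A)
  rw [ZMod.frobenius_zmod, MvPowerSeries.map_id] at h
  exact h

theorem fmod_two_mul {k : ℕ} (hk : k ≠ 0) : fmod (2 * k) = fmod k ^ 2 := by
  rw [fmod_eq_expand (Nat.mul_ne_zero two_ne_zero hk), expand_mul 2 two_ne_zero k hk,
    expand_two_eq_sq, fmod_eq_expand hk]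

theorem fmod_two : fmod 2 = fmod 1 ^ 2 := by
  rw [← fmod_two_mul one_ne_zero, mul_one]

theorem fmod_ten : fmod 10 = fmod 5 ^ 2 := by
  rw [← fmod_two_mul (by norm_num)]

theorem coeff_two_mul_sq (A : PowerSeries (ZMod 2)) (n : ℕ) :
    coeff (2 * n) (A ^ 2) = coeff n A := by
  rw [← expand_two_eq_sq, coeff_expand_mul]

theorem coeff_two_mul_add_one_sq (A : PowerSeries (ZMod 2)) (n : ℕ) :
    coeff (2 * n + 1) (A ^ 2) = 0 := by
  rw [← expand_two_eq_sq, coeff_expand_of_not_dvd _ _ _ (by omega)]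

open Classical in
theorem coeff_fmod {k : ℕ} (hk : k ≠ 0) (n : ℕ) :
    coeff n (fmod k) = if ∃ i, k * pentagonal i = n then 1 else 0 := by
  rw [fmod_eq_expand hk]
  split_ifs with h
  · obtain ⟨i, rfl⟩ := h
    rw [coeff_expand_mul, coeff_pentagonalSeries_pentagonal]
    rcases Int.units_eq_one_or (Int.negOnePow i) with h | h <;> rw [h] <;> decide
  · rw [coeff_expand]
    split_ifs with hd
    · obtain ⟨m, rfl⟩ := hd
      rw [Nat.mul_div_cancel_left _ (Nat.pos_of_ne_zero hk), coeff_pentagonalSeries_eq_zero]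
      rintro ⟨i, rfl⟩
      exact h ⟨i, rfl⟩
    · rfl

theorem coeff_fmod_mul_fmod {a b : ℕ} (ha : a ≠ 0) (hb : b ≠ 0) (N : ℕ) :
    coeff N (fmod a * fmod b) = ((thetaReps a b (24 * N + a + b)).ncard : ZMod 2) := by
  classical
  set s : Set (ℤ × ℤ) := {z | a * pentagonal z.1 + b * pentagonal z.2 = N}
  have hpent : ∀ i : ℤ, 24 * (pentagonal i : ℤ) + 1 = (1 - 6 * i) ^ 2 := fun i => by
    linear_combination 12 * two_mul_natCast_pentagonal i
  have h1 : thetaReps a b (24 * N + a + b) =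
      (fun z : ℤ × ℤ => (1 - 6 * z.1, 1 - 6 * z.2)) '' s := by
    ext ⟨u, v⟩
    simp only [thetaReps, s, Set.mem_ofPred_eq, Set.mem_image, Prod.exists, Prod.mk.injEq]
    constructor
    · rintro ⟨h, hu, hv⟩
      obtain ⟨i, rfl⟩ : ∃ i, u = 1 - 6 * i := ⟨(1 - u) / 6, by omega⟩
      obtain ⟨j, rfl⟩ : ∃ j, v = 1 - 6 * j := ⟨(1 - v) / 6, by omega⟩
      refine ⟨i, j, ?_, rfl, rfl⟩
      rw [← hpent, ← hpent] at h
      zify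
      linarith
    · rintro ⟨i, j, h, rfl, rfl⟩
      refine ⟨?_, by omega, by omega⟩
      rw [← hpent, ← hpent, ← h]
      push_cast
      ring
  have h2 : (((Finset.HasAntidiagonal.antidiagonal N).filter fun z : ℕ × ℕ =>
      (∃ i, a * pentagonal i = z.1) ∧ ∃ j, b * pentagonal j = z.2 : Finset (ℕ × ℕ)) :
      Set (ℕ × ℕ)) =
      (fun z : ℤ × ℤ => (a * pentagonal z.1, b * pentagonal z.2)) '' s := by
    ext ⟨m, n⟩
    simp only [s, Finset.coe_filter, Finset.HasAntidiagonal.mem_antidiagonal, Set.mem_ofPred_eq, Set.mem_image,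
      Prod.exists, Prod.mk.injEq]
    constructor
    · rintro ⟨h, ⟨i, rfl⟩, ⟨j, rfl⟩⟩
      exact ⟨i, j, h, rfl, rfl⟩
    · rintro ⟨i, j, h, rfl, rfl⟩
      exact ⟨h, ⟨i, rfl⟩, ⟨j, rfl⟩⟩
  rw [h1, Set.ncard_image_of_injective, ← Set.ncard_image_of_injective s
    (f := fun z : ℤ × ℤ => (a * pentagonal z.1, b * pentagonal z.2)), ← h2, Set.ncard_coe_finset,
    coeff_mul, Finset.card_filter]
  · push_cast
    refine Finset.sum_congr rfl fun z _ => ?_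
    rw [coeff_fmod ha, coeff_fmod hb, ite_and, ite_mul, one_mul, zero_mul]
  · rintro ⟨x, y⟩ ⟨z, w⟩ h
    simpa [ha, hb] using h
  · rintro ⟨x, y⟩ ⟨z, w⟩ h
    simpa using h

-- Jacobi's identity modulo 2, read off from `f₁³ ≡ f₁ f₂`.
open Classical in
theorem coeff_fmod_one_pow_three (n : ℕ) :
    coeff n (fmod 1 ^ 3) = if IsSquare (8 * n + 1 : ℤ) then 1 else 0 := by
  have h := coeff_fmod_mul_fmod one_ne_zero two_ne_zero n
  rw [fmod_two, ← pow_succ'] at h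
  rw [h, show (24 * n + (1 : ℕ) + (2 : ℕ) : ℤ) = 3 * (8 * n + 1) by push_cast; ring]
  have h2 := ncard_reps_two (8 * n + 1) (by omega)
  push_cast at h2 ⊢
  rw [ncard_thetaReps_one_two (by omega), h2]

open Classical in
theorem coeff_fmod_five_pow_three (n : ℕ) :
    coeff n (fmod 5 ^ 3) = if ∃ y : ℤ, 5 * y ^ 2 = 8 * n + 5 then 1 else 0 := by
  have h : fmod 5 ^ 3 = expand 5 (by norm_num) (fmod 1 ^ 3) := by
    rw [map_pow, fmod_eq_expand (k := 1) one_ne_zero, fmod_eq_expand (k := 5) (by norm_num),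
      ← expand_mul]
  rw [h, coeff_expand]
  split_ifs with h1 h2 h2
  · obtain ⟨m, rfl⟩ := h1
    obtain ⟨y, hy⟩ := h2
    rw [Nat.mul_div_cancel_left _ (by norm_num), coeff_fmod_one_pow_three, if_pos]
    exact ⟨y, by push_cast at hy; linarith⟩
  · obtain ⟨m, rfl⟩ := h1
    rw [Nat.mul_div_cancel_left _ (by norm_num), coeff_fmod_one_pow_three, if_neg]
    rintro ⟨y, hy⟩
    exact h2 ⟨y, by push_cast; linarith⟩
  · obtain ⟨y, hy⟩ := h2
    omega
  · rfl

/-- Modulo `2`, `f₁ f₅ = f₂³ + q f₁₀³`. -/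
theorem fmod_one_mul_fmod_five : fmod 1 * fmod 5 = (fmod 1 ^ 3) ^ 2 + X * (fmod 5 ^ 3) ^ 2 := by
  classical
  ext N
  have h := coeff_fmod_mul_fmod one_ne_zero (b := 5) (by norm_num) N
  rw [h, show (24 * N + (1 : ℕ) + (5 : ℕ) : ℤ) = 6 * (4 * N + 1) by push_cast; ring]
  have h2 := ncard_reps_five (4 * N + 1) (by omega)
  push_cast at h2 ⊢
  rw [ncard_thetaReps_one_five (by omega), h2, map_add]
  -- `4N + 1` is 1 modulo 8 for even `N`, excluding `5y²`, and 5 modulo 8 for odd `N`, excluding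
  -- squares.
  obtain ⟨n, rfl | rfl⟩ := N.even_or_odd'
  · rw [coeff_two_mul_sq, coeff_fmod_one_pow_three]
    congr 1
    · congr 2
      push_cast
      ring
    · rw [if_neg]
      · cases n with
        | zero => simp
        | succ n =>
          rw [show 2 * (n + 1) = (2 * n + 1) + 1 by ring, coeff_succ_X_mul,
            coeff_two_mul_add_one_sq]
      · rintro ⟨y, hy⟩
        rcases sq_emod_eight y with h | h <;> omega
  · rw [coeff_two_mul_add_one_sq, coeff_succ_X_mul, coeff_two_mul_sq, coeff_fmod_five_pow_three,
      if_neg]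
    · congr 3
      ext y
      push_cast
      rw [show (4 * (2 * n + 1) + 1 : ℤ) = 8 * n + 5 by ring]
    · rintro ⟨y, hy⟩
      rw [← pow_two] at hy
      rcases sq_emod_eight y with h | h <;> omega

/-! ### Generating function of `a 2 5` and its dissections -/

/-- The generating function of `a 2 5` modulo `2`. -/
noncomputable def amod : PowerSeries (ZMod 2) :=
  PowerSeries.mk fun n => (a 2 5 n : ZMod 2)

theorem hasProd_amod :
    HasProd (fun i : ℕ => if ¬ 2 ∣ i + 1 ∧ ¬ 5 ∣ i + 1 then (1 - X ^ (i + 1) : PowerSeries (ZMod 2))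
      else 1) amod := by
  convert! Nat.Partition.hasProd_genFun (fun i c => if c ≤ 1 ∧ ¬ 2 ∣ i ∧ ¬ 5 ∣ i then (1 : ZMod 2)
    else 0) using 1
  · ext1 i
    rw [tsum_eq_single 0]
    · split_ifs with h1 h2 h2
      · rw [one_smul, zero_add, mul_one, sub_eq_add_neg]
        congr 1
        ext n
        rw [map_neg, CharTwo.neg_eq]
      · simp_all
      · simp_all
      · simp
    · intro j hj
      rw [if_neg (by omega), zero_smul]
  · ext n
    simp_rw [amod, coeff_mk, Nat.Partition.coeff_genFun, a, Finset.card_filter, Finsupp.prod,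
      Finset.prod_boole]
    push_cast
    refine Finset.sum_congr rfl fun π _ => if_congr ?_ rfl rfl
    simp only [Multiset.toFinsupp_support, Multiset.mem_toFinset, Multiset.toFinsupp_apply,
      Multiset.nodup_iff_count_le_one]
    constructor
    · rintro ⟨h1, h2⟩ i hi
      exact ⟨h1 i, h2 i hi⟩
    · intro h
      refine ⟨fun i => ?_, fun i hi => (h i hi).2⟩
      by_cases hi : i ∈ π.parts
      · exact (h i hi).1
      · simp [Multiset.count_eq_zero_of_notMem hi]

theorem hasProd_fmod_ite {k : ℕ} (hk : 1 ≤ k) :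
    HasProd (fun i : ℕ => if k ∣ i + 1 then (1 - X ^ (i + 1) : PowerSeries (ZMod 2)) else 1)
      (fmod k) := by
  have hinj : Function.Injective fun m : ℕ => k * (m + 1) - 1 := fun m n h => by
    have h1 : 1 ≤ k * (m + 1) := Nat.mul_pos hk (by omega)
    have h2 : 1 ≤ k * (n + 1) := Nat.mul_pos hk (by omega)
    have h3 : k * (m + 1) = k * (n + 1) := by simp only at h; omega
    have := Nat.eq_of_mul_eq_mul_left hk h3
    omega
  rw [← hinj.hasProd_iff]
  · convert hasProd_fmod hk using 1
    ext1 m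
    have h1 : 1 ≤ k * (m + 1) := Nat.mul_pos hk (by omega)
    simp [Nat.sub_add_cancel h1]
  · intro i hi
    rw [if_neg]
    rintro ⟨m, hm⟩
    have hm0 : m ≠ 0 := by rintro rfl; simp at hm
    refine hi ⟨m - 1, ?_⟩
    simp only
    rw [Nat.sub_add_cancel (by omega), ← hm]
    omega

theorem fmod_ne_zero {k : ℕ} (hk : k ≠ 0) : fmod k ≠ 0 := by
  classical
  intro h
  have := coeff_fmod hk 0
  rw [if_pos ⟨0, by simp [pentagonal_def]⟩, h] at this
  simp at this

/-- Inclusion-exclusion on divisibility by 2 and 5 gives `f₁ f₁₀ / (f₂ f₅)`; modulo 2, `f₂ = f₁²`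
and `f₁₀ = f₅²`. -/
theorem amod_mul_fmod_one : amod * fmod 1 = fmod 5 := by
  have h : amod * fmod 2 * fmod 5 = fmod 1 * fmod 10 := by
    refine ((hasProd_amod.mul (hasProd_fmod_ite (by norm_num))).mul
      (hasProd_fmod_ite (by norm_num))).unique ?_
    convert (hasProd_fmod_ite (k := 1) (by norm_num)).mul (hasProd_fmod_ite (k := 10)
      (by norm_num)) using 1
    ext1 i
    by_cases h2 : 2 ∣ i + 1 <;> by_cases h5 : 5 ∣ i + 1
    · simp [h2, h5, show 10 ∣ i + 1 by omega]
    · simp [h2, h5, show ¬ 10 ∣ i + 1 by omega]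
    · simp [h2, h5, show ¬ 10 ∣ i + 1 by omega]
    · simp [h2, h5, show ¬ 10 ∣ i + 1 by omega]
  rw [fmod_two, fmod_ten] at h
  refine mul_right_cancel₀ (mul_ne_zero (fmod_ne_zero one_ne_zero) (fmod_ne_zero (k := 5)
    (by norm_num))) ?_
  linear_combination h

/-- The congruence for `f₁ f₅` divided by `f₁²`. Squares have only even exponents, so this separates
the parities. -/
theorem amod_eq : amod = (fmod 1 ^ 2) ^ 2 + X * (amod * fmod 5 ^ 2) ^ 2 := by
  refine mul_right_cancel₀ (pow_ne_zero 2 (fmod_ne_zero one_ne_zero)) ?_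
  linear_combination fmod_one_mul_fmod_five + fmod 1 * amod_mul_fmod_one
    - X * fmod 5 ^ 4 * (amod * fmod 1 + fmod 5) * amod_mul_fmod_one

theorem amod_mul_sq : amod * fmod 5 ^ 2 =
    (fmod 2 * fmod 5) ^ 2 + X * (amod * fmod 5 ^ 3) ^ 2 := by
  rw [fmod_two]
  linear_combination fmod 5 ^ 2 * amod_eq

theorem a_four_mul_add_one (n : ℕ) :
    (a 2 5 (4 * n + 1) : ZMod 2) = coeff n (fmod 2 * fmod 5) := by
  have h1 : (a 2 5 (4 * n + 1) : ZMod 2) = coeff (2 * (2 * n) + 1) amod := by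
    rw [amod, coeff_mk]
    congr 2
    ring
  have h2 : coeff (2 * n) (X * (amod * fmod 5 ^ 3) ^ 2) = 0 := by
    cases n with
    | zero => simp
    | succ n =>
      rw [show 2 * (n + 1) = (2 * n + 1) + 1 by ring, coeff_succ_X_mul, coeff_two_mul_add_one_sq]
  rw [h1, amod_eq, map_add, coeff_two_mul_add_one_sq, zero_add, coeff_succ_X_mul,
    coeff_two_mul_sq, amod_mul_sq, map_add, h2, coeff_two_mul_sq, add_zero]

theorem a_eq_ncard_thetaReps {m : ℕ} (hm : m % 4 = 1) :
    (a 2 5 m : ZMod 2) = ((thetaReps 2 5 (6 * m + 1)).ncard : ZMod 2) := by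
  obtain ⟨n, rfl⟩ : ∃ n, m = 4 * n + 1 := ⟨m / 4, by omega⟩
  rw [a_four_mul_add_one, coeff_fmod_mul_fmod two_ne_zero (by norm_num)]
  congr 3
  push_cast
  ring

theorem seriesModEq_two_iff {A B : PowerSeries ℤ} :
    SeriesModEq 2 A B ↔ ∀ n, coeff n (PowerSeries.map (Int.castRingHom (ZMod 2)) A) =
      coeff n (PowerSeries.map (Int.castRingHom (ZMod 2)) B) := by
  refine forall_congr' fun n => ?_
  rw [coeff_map, coeff_map]
  exact (ZMod.intCast_eq_intCast_iff _ _ 2).symm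

theorem prime_pow_even_mod {p : ℕ} (hpp : p.Prime) (hp : 5 < p) (k : ℕ) :
    p ^ (2 * k) % 24 = 1 := by
  rw [pow_mul, Nat.pow_mod]
  have h : p ^ 2 % 24 = 1 := by
    have h6 := prime_emod_six hpp hp
    have h24 : p % 24 = 1 ∨ p % 24 = 5 ∨ p % 24 = 7 ∨ p % 24 = 11 ∨ p % 24 = 13 ∨ p % 24 = 17 ∨
      p % 24 = 19 ∨ p % 24 = 23 := by omega
    rcases h24 with h | h | h | h | h | h | h | h <;> simp [h, Nat.pow_mod]
  simp [h]

end RegularPartitions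

/-! ### Assembly of the four congruences -/

open RegularPartitions in
theorem theorem1p2 (p : ℕ) [Fact p.Prime] (hp : 5 < p) (hleg : legendreSym p (-10) = -1)
    (γ : ℕ) :
    RegularPartitions.SeriesModEq 2
      (PowerSeries.mk fun n : ℕ =>
        (RegularPartitions.a 2 5 (4 * p ^ (2 * γ) * n + (7 * p ^ (2 * γ) - 1) / 6) : ℤ))
      (RegularPartitions.f 2 * RegularPartitions.f 5) ∧
    (∀ n j : ℕ, 1 ≤ j → j ≤ p - 1 →
      RegularPartitions.a 2 5
        (4 * p ^ (2 * γ + 1) * (p * n + j) + (7 * p ^ (2 * γ + 2) - 1) / 6) ≡ 0 [MOD 2]) ∧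
    RegularPartitions.SeriesModEq 2
      (PowerSeries.mk fun n : ℕ =>
        (RegularPartitions.a 2 5 (20 * p ^ (2 * γ) * n + (55 * p ^ (2 * γ) - 1) / 6) : ℤ))
      (RegularPartitions.f 1 * RegularPartitions.f 10) ∧
    (∀ n j : ℕ, 1 ≤ j → j ≤ p - 1 →
      RegularPartitions.a 2 5
        (20 * p ^ (2 * γ + 1) * (p * n + j) + (55 * p ^ (2 * γ + 2) - 1) / 6) ≡ 0 [MOD 2]) := by
  have hpp : p.Prime := Fact.out
  have hP := prime_pow_even_mod hpp hp γ
  have hP' := prime_pow_even_mod hpp hp (γ + 1)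
  rw [mul_add, mul_one] at hP'
  -- Both 7 and 55 are 7 modulo 24, so every argument in the theorem is 1 modulo 4.
  have arg : ∀ c P A : ℕ, P % 24 = 1 → c % 24 = 7 →
      (4 * A + (c * P - 1) / 6) % 4 = 1 ∧
      (6 * ((4 * A + (c * P - 1) / 6 : ℕ) : ℤ) + 1) = 24 * A + c * P := by
    intro c P A h1 h2
    obtain ⟨s, rfl⟩ : ∃ s, P = 24 * s + 1 := ⟨P / 24, by omega⟩
    obtain ⟨t, rfl⟩ : ∃ t, c = 24 * t + 7 := ⟨c / 24, by omega⟩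
    have h3 : ((24 * t + 7) * (24 * s + 1) - 1) / 6 = 4 * (24 * t * s + t + 7 * s) + 1 := by
      rw [show (24 * t + 7) * (24 * s + 1) = 6 * (4 * (24 * t * s + t + 7 * s) + 1) + 1 by ring]
      omega
    rw [h3]
    refine ⟨by omega, ?_⟩
    push_cast
    ring
  have hnd : ∀ c n j : ℕ, (∀ q, q ∣ c → q.Prime → q ≤ 5) → 1 ≤ j → j ≤ p - 1 → ∀ e : ℤ,
      ¬ (p : ℤ) ∣ c * (p * n + j) + e * p := by
    intro c n j hc h1 h2 e h
    have h3 : (p : ℤ) ∣ ((c * j : ℕ) : ℤ) := by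
      have := dvd_sub h (Dvd.intro (c * n + e) rfl : (p : ℤ) ∣ p * (c * n + e))
      refine this.trans ⟨1, ?_⟩
      push_cast
      ring
    rcases hpp.dvd_mul.mp (Int.natCast_dvd_natCast.mp h3) with h4 | h4
    · have := hc p h4 hpp
      omega
    · have := Nat.le_of_dvd h1 h4
      omega
  have h24 : ∀ q, q ∣ 24 → q.Prime → q ≤ 5 := by
    intro q hq hqp
    have := (Nat.Prime.dvd_mul hqp (m := 8) (n := 3)).mp hq
    rcases this with h | h
    · have := Nat.le_of_dvd two_pos (hqp.dvd_of_dvd_pow (m := 2) (n := 3) h); omega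
    · have := Nat.le_of_dvd three_pos h; omega
  have h120 : ∀ q, q ∣ 120 → q.Prime → q ≤ 5 := by
    intro q hq hqp
    rcases (Nat.Prime.dvd_mul hqp (m := 24) (n := 5)).mp hq with h | h
    · exact h24 q h hqp
    · exact Nat.le_of_dvd (by norm_num) h
  have vanish : ∀ c d n j : ℕ, (∀ q, q ∣ 24 * d → q.Prime → q ≤ 5) → c % 24 = 7 → 1 ≤ j →
      j ≤ p - 1 →
      a 2 5 (4 * d * p ^ (2 * γ + 1) * (p * n + j) + (c * p ^ (2 * γ + 2) - 1) / 6) ≡ 0 [MOD 2] := by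
    intro c d n j hd hc h1 h2
    have ha := arg c (p ^ (2 * γ + 2)) (d * p ^ (2 * γ + 1) * (p * n + j)) hP' hc
    rw [← ZMod.natCast_eq_natCast_iff, mul_assoc 4, mul_assoc 4, a_eq_ncard_thetaReps ha.1, ha.2]
    push_cast
    rw [show (24 * (d * p ^ (2 * γ + 1) * (p * n + j)) + c * p ^ (2 * γ + 2) : ℤ) =
      p ^ (2 * γ) * (p * (((24 * d : ℕ) : ℤ) * (p * n + j) + c * p)) by push_cast; ring,
      ncard_thetaReps_prime_pow_mul hp hleg,
      thetaReps_prime_mul_eq_empty hp hleg (hnd _ n j hd h1 h2 c), Set.ncard_empty]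
    rfl
  refine ⟨?_, fun n j => vanish 7 1 n j h24 (by norm_num), ?_,
    fun n j => vanish 55 5 n j h120 (by norm_num)⟩
  · rw [seriesModEq_two_iff]
    intro n
    have ha := arg 7 (p ^ (2 * γ)) (p ^ (2 * γ) * n) hP (by norm_num)
    rw [map_mul, PowerSeries.coeff_map, PowerSeries.coeff_mk, mul_assoc]
    change ((a 2 5 _ : ℤ) : ZMod 2) = PowerSeries.coeff n (fmod 2 * fmod 5)
    rw [Int.cast_natCast, a_eq_ncard_thetaReps ha.1, ha.2,
      coeff_fmod_mul_fmod two_ne_zero (by norm_num)]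
    push_cast
    rw [← ncard_thetaReps_prime_pow_mul hp hleg γ (24 * n + 2 + 5)]
    congr 3
    ring
  · rw [seriesModEq_two_iff]
    intro n
    have ha := arg 55 (p ^ (2 * γ)) (5 * p ^ (2 * γ) * n) hP (by norm_num)
    rw [map_mul, PowerSeries.coeff_map, PowerSeries.coeff_mk,
      show 20 * p ^ (2 * γ) * n = 4 * (5 * p ^ (2 * γ) * n) by ring]
    change ((a 2 5 _ : ℤ) : ZMod 2) = PowerSeries.coeff n (fmod 1 * fmod 10)
    rw [Int.cast_natCast, a_eq_ncard_thetaReps ha.1, ha.2,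
      coeff_fmod_mul_fmod one_ne_zero (by norm_num)]
    push_cast
    -- Here `6m + 1 = p^(2γ) * 5 * (24n + 11)`; the factor 5 turns `2u² + 5v²` into `x² + 10y²`.
    rw [← ncard_thetaReps_two_five,
      ← ncard_thetaReps_prime_pow_mul hp hleg γ (5 * (24 * n + 1 + 10))]
    congr 3
    ring
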